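/- All C*-algebras are unital, and C*-subalgebras and extensions are unital (they share the unit). For a C*-algebra $A$, let $A^{**}$ be its double dual with its usual C*-algebra structure, i.e. the enveloping von Neumann algebra $\pi_u(A)''$ of $A$, where $\pi_u$ is the universal representation of $A$ (the direct sum of the GNS representations of all states of $A$); $A$ is canonically embedded in $A^{**}$. If $A$ is a C*-subalgebra of a C*-algebra $B$, then $A$ is called relatively weakly injective in $B$ if there is a unital completely positive map $\phi : B \to A^{**}$ such that $\phi(a) = a$ for all $a \in A$. A C*-algebra $A$ has the weak expectation property (WEP) if it is relatively weakly injective in every C*-algebra $B$ containing it as a C*-subalgebra. **Proposition.** Let $A$ be a nonseparable C*-algebra, and let $\mathcal{C}$ be a collection of separable C*-subalgebras of $A$ such that every $C \in \mathcal{C}$ has WEP and such that $\mathcal{C}$ is cofinal, i.e. every separable C*-subalgebra of $A$ is contained in some $C \in \mathcal{C}$. Then $A$ has WEP. -/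

import Mathlib

open scoped ComplexOrder ENNReal

universe u v

noncomputable section

namespace CStarWEP

section Bicommutant

variable {A H : Type*} [CStarAlgebra A] [NormedAddCommGroup H] [InnerProductSpace ℂ H]
  [CompleteSpace H]

/-- The double commutant `π(A)''` of the image of a representation `π` of `A` on a Hilbert space
`H`, that is, the von Neumann algebra generated by `π(A)`. -/
def bicommutant (π : A →⋆ₐ[ℂ] (H →L[ℂ] H)) : StarSubalgebra ℂ (H →L[ℂ] H) :=
  StarSubalgebra.centralizer ℂ
    (StarSubalgebra.centralizer ℂ (Set.range π) : Set (H →L[ℂ] H))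

instance bicommutant_isClosed (π : A →⋆ₐ[ℂ] (H →L[ℂ] H)) :
    IsClosed (bicommutant π : Set (H →L[ℂ] H)) := by
  rw [bicommutant, StarSubalgebra.coe_centralizer]
  exact Set.isClosed_centralizer _

/-- The von Neumann algebra `π(A)''` is a C⋆-algebra, as a norm-closed ⋆-subalgebra of the bounded
operators. -/
instance bicommutantCStarAlgebra (π : A →⋆ₐ[ℂ] (H →L[ℂ] H)) : CStarAlgebra (bicommutant π) :=
  StarSubalgebra.cstarAlgebra (bicommutant π)

theorem mem_bicommutant (π : A →⋆ₐ[ℂ] (H →L[ℂ] H)) (a : A) : π a ∈ bicommutant π := by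
  rw [bicommutant, StarSubalgebra.mem_centralizer_iff]
  intro g hg
  have hg' := (StarSubalgebra.mem_centralizer_iff ℂ).mp hg (π a) ⟨a, rfl⟩
  have hs := (StarSubalgebra.mem_centralizer_iff ℂ).mp
    (star_mem (s := StarSubalgebra.centralizer ℂ (Set.range π)) hg) (π a) ⟨a, rfl⟩
  exact ⟨hg'.1.symm, hs.1.symm⟩

/-- The representation `π`, as a ⋆-homomorphism from `A` into `π(A)''`. -/
def toBicommutant (π : A →⋆ₐ[ℂ] (H →L[ℂ] H)) : A →⋆ₐ[ℂ] bicommutant π :=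
  π.codRestrict (bicommutant π) (mem_bicommutant π)

end Bicommutant

section Bidual

variable (A : Type u) [CStarAlgebra A] [PartialOrder A] [StarOrderedRing A]

/-- The states of a unital C⋆-algebra: positive linear functionals taking the value `1` at `1`. -/
abbrev State : Type u := {f : A →ₚ[ℂ] ℂ // f 1 = 1}

/-- The Hilbert space of the universal representation: the Hilbert space direct sum, over all
states `f` of `A`, of the GNS spaces of `f`. -/
def UniversalSpace : Type u := lp (fun f : State A => f.1.GNS) 2

instance : NormedAddCommGroup (UniversalSpace A) :=
  inferInstanceAs (NormedAddCommGroup (lp (fun f : State A => f.1.GNS) 2))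

instance : InnerProductSpace ℂ (UniversalSpace A) :=
  inferInstanceAs (InnerProductSpace ℂ (lp (fun f : State A => f.1.GNS) 2))

instance : CompleteSpace (UniversalSpace A) :=
  inferInstanceAs (CompleteSpace (lp (fun f : State A => f.1.GNS) 2))

/-- The operator `⨁ π_f(a)` on the universal Hilbert space, where `π_f` is the GNS representation
of the state `f`. -/
def universalOp (a : A) : UniversalSpace A →L[ℂ] UniversalSpace A :=
  lp.mapCLM (E := fun f : State A => f.1.GNS) (F := fun f : State A => f.1.GNS) 2
    (fun f : State A => f.1.gnsStarAlgHom a) (norm_nonneg a)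
    (fun f => NonUnitalStarAlgHom.norm_apply_le f.1.gnsStarAlgHom a)

variable {A}

/-- The `f`-th component of a vector in the universal Hilbert space. -/
def UniversalSpace.comp (x : UniversalSpace A) (f : State A) : f.1.GNS :=
  (show lp (fun f : State A => f.1.GNS) 2 from x) f

theorem UniversalSpace.ext {x y : UniversalSpace A} (h : ∀ f, x.comp f = y.comp f) : x = y :=
  lp.ext (funext h)

theorem universalOp_comp (a : A) (x : UniversalSpace A) (f : State A) :
    (universalOp A a x).comp f = f.1.gnsStarAlgHom a (x.comp f) := rfl

theorem UniversalSpace.inner_eq_tsum (x y : UniversalSpace A) :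
    inner ℂ x y = ∑' f : State A, inner ℂ (x.comp f) (y.comp f) := rfl

variable (A)

/-- The universal representation `a ↦ ⨁ π_f(a)` of `A`: the direct sum over all states `f` of the
GNS representations `π_f`. -/
def universalRep : A →⋆ₐ[ℂ] (UniversalSpace A →L[ℂ] UniversalSpace A) where
  toFun a := universalOp A a
  map_one' := ContinuousLinearMap.ext fun x => UniversalSpace.ext fun f => by
    rw [universalOp_comp, map_one]; rfl
  map_mul' a b := ContinuousLinearMap.ext fun x => UniversalSpace.ext fun f => by
    rw [universalOp_comp, map_mul]; rfl
  map_zero' := ContinuousLinearMap.ext fun x => UniversalSpace.ext fun f => by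
    rw [universalOp_comp, map_zero]; rfl
  map_add' a b := ContinuousLinearMap.ext fun x => UniversalSpace.ext fun f => by
    rw [universalOp_comp, map_add]; rfl
  commutes' r := ContinuousLinearMap.ext fun x => UniversalSpace.ext fun f => by
    rw [universalOp_comp, Algebra.algebraMap_eq_smul_one, Algebra.algebraMap_eq_smul_one,
      map_smul, map_one]
    rfl
  map_star' a := by
    refine (ContinuousLinearMap.eq_adjoint_iff _ _).mpr fun x y => ?_
    rw [UniversalSpace.inner_eq_tsum, UniversalSpace.inner_eq_tsum]
    refine tsum_congr fun f => ?_
    rw [universalOp_comp, universalOp_comp, map_star, ContinuousLinearMap.star_eq_adjoint,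
      ContinuousLinearMap.adjoint_inner_left]

/-- The double dual `A⋆⋆` of `A` as a C⋆-algebra (indeed a von Neumann algebra): the enveloping
von Neumann algebra of `A`, that is, the double commutant of the image of `A` under its universal
representation. -/
abbrev Bidual : Type u := bicommutant (universalRep A)

/-- The canonical embedding of `A` into `A⋆⋆`. -/
abbrev toBidual : A →⋆ₐ[ℂ] Bidual A := toBicommutant (universalRep A)

end Bidual

/-- Let the injective ⋆-homomorphism `ι : A → B` exhibit `A` as a unital C⋆-subalgebra of `B`. Then
`A` is relatively weakly injective in `B` if there is a weak conditional expectation, i.e. a unital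
completely positive map `φ : B → A⋆⋆` whose restriction to `A` is the canonical embedding of `A`
into `A⋆⋆`. All C⋆-algebras carry their usual order, given by the positive elements. -/
def IsRelativelyWeaklyInjective {A : Type u} {B : Type v} [CStarAlgebra A] [CStarAlgebra B]
    (ι : A →⋆ₐ[ℂ] B) : Prop :=
  letI := CStarAlgebra.spectralOrder A
  letI := CStarAlgebra.spectralOrderedRing A
  letI := CStarAlgebra.spectralOrder B
  letI := CStarAlgebra.spectralOrderedRing B
  letI := CStarAlgebra.spectralOrder (Bidual A)
  letI := CStarAlgebra.spectralOrderedRing (Bidual A)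
  ∃ φ : CompletelyPositiveMap B (Bidual A), φ 1 = 1 ∧ ∀ a : A, φ (ι a) = toBidual A a

/-- A unital C⋆-algebra has the weak expectation property (WEP) if it is relatively weakly
injective in every C⋆-algebra that contains it as a unital C⋆-subalgebra. The containing algebras
live in a universe at least as large as that of `A`. -/
def HasWEP (A : Type u) [CStarAlgebra A] : Prop :=
  ∀ (B : Type (max u v)) [CStarAlgebra B] (ι : A →⋆ₐ[ℂ] B), Function.Injective ι →
    IsRelativelyWeaklyInjective ι

end CStarWEP

end

/-! Let `A` sit inside `B`. Each `C` in `𝒞` also sits inside `B`, so its WEP gives a unital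
completely positive map `B → C⋆⋆` fixing `C`. The inclusion `C → A` extends to a ⋆-homomorphism `C⋆⋆
→ A⋆⋆` (`bidualMap`), and composing gives unital completely positive maps `φ_C : B → A⋆⋆` fixing
`C`. Cofinality makes `𝒞` directed with union `A`, so each `a` is eventually fixed, and a
point-weak-operator limit of the `φ_C` along an ultrafilter is a weak expectation for `A`.

Two facts carry this. Every representation `π` of `A` extends to `A⋆⋆` with values in `π(A)''`
(`normalExtension`): every vector of `H` is in the range of an intertwiner `V` from the universal
representation, and `T` must act by `V ξ ↦ V (T ξ)`. Limits of completely positive maps stay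
completely positive and inside the double commutant (`exists_completelyPositiveMap_tendsto`), since
both conditions can be tested on matrix coefficients. -/

noncomputable section

namespace CStarWEP

/-! ### Cyclic subspaces as GNS spaces of vector functionals -/

section VectorFunctional

variable {A H : Type*} [CStarAlgebra A]
  [NormedAddCommGroup H] [InnerProductSpace ℂ H] [CompleteSpace H]

theorem inner_map_star_mul (π : A →⋆ₐ[ℂ] (H →L[ℂ] H)) (a b : A) (x y : H) :
    inner ℂ x (π (star a * b) y) = inner ℂ (π a x) (π b y) := by
  have h : π (star a * b) = (π a).adjoint * π b := by
    rw [map_mul, map_star, ContinuousLinearMap.star_eq_adjoint]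
  rw [h]
  exact ContinuousLinearMap.adjoint_inner_right (π a) x (π b y)

variable [PartialOrder A] [StarOrderedRing A]

/-- The positive functional `a ↦ ⟪x, π a x⟫` on `A`. -/
def vectorFunctional (π : A →⋆ₐ[ℂ] (H →L[ℂ] H)) (x : H) : A →ₚ[ℂ] ℂ :=
  PositiveLinearMap.mk₀
    { toFun a := inner ℂ x (π a x)
      map_add' a b := by simp
      map_smul' c a := by simp }
    (fun a ha => by
      obtain ⟨b, rfl⟩ := CStarAlgebra.nonneg_iff_eq_star_mul_self.mp ha
      change 0 ≤ inner ℂ x (π (star b * b) x)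
      rw [inner_map_star_mul]
      rw [inner_self_eq_norm_sq_to_K, ← RCLike.ofReal_pow]
      exact RCLike.ofReal_nonneg.mpr (sq_nonneg _))

theorem vectorFunctional_apply (π : A →⋆ₐ[ℂ] (H →L[ℂ] H)) (x : H) (a : A) :
    vectorFunctional π x a = inner ℂ x (π a x) := rfl

/-- The isometry from the pre-GNS space of a vector functional onto the orbit of the vector. -/
def preGNSIsometry (π : A →⋆ₐ[ℂ] (H →L[ℂ] H)) (x : H) :
    (vectorFunctional π x).PreGNS →ₗᵢ[ℂ] H where
  toFun a := π ((vectorFunctional π x).ofPreGNS a) x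
  map_add' a b := by simp
  map_smul' c a := by simp
  norm_map' a := by
    rw [PositiveLinearMap.preGNS_norm_def, vectorFunctional_apply, inner_map_star_mul,
      @norm_eq_sqrt_re_inner ℂ]
    rfl

/-- The isometry from the GNS space of a vector functional onto the cyclic subspace generated by
the vector. -/
def gnsIsometry (π : A →⋆ₐ[ℂ] (H →L[ℂ] H)) (x : H) :
    (vectorFunctional π x).GNS →L[ℂ] H :=
  (preGNSIsometry π x).toContinuousLinearMap.extend
    (UniformSpace.Completion.toComplL (𝕜 := ℂ) (E := (vectorFunctional π x).PreGNS))

theorem gnsIsometry_coe (π : A →⋆ₐ[ℂ] (H →L[ℂ] H)) (x : H) (a : (vectorFunctional π x).PreGNS) :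
    gnsIsometry π x a = π ((vectorFunctional π x).ofPreGNS a) x :=
  ContinuousLinearMap.extend_eq _ UniformSpace.Completion.denseRange_coe
    (UniformSpace.Completion.isUniformInducing_coe _) a

theorem norm_gnsIsometry (π : A →⋆ₐ[ℂ] (H →L[ℂ] H)) (x : H)
    (y : (vectorFunctional π x).GNS) : ‖gnsIsometry π x y‖ = ‖y‖ := by
  induction y using UniformSpace.Completion.induction_on with
  | hp => exact isClosed_eq (by fun_prop) (by fun_prop)
  | ih a =>
    rw [gnsIsometry_coe, UniformSpace.Completion.norm_coe]
    exact (preGNSIsometry π x).norm_map a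

theorem gnsIsometry_gnsStarAlgHom (π : A →⋆ₐ[ℂ] (H →L[ℂ] H)) (x : H) (c : A)
    (y : (vectorFunctional π x).GNS) :
    gnsIsometry π x ((vectorFunctional π x).gnsStarAlgHom c y) = π c (gnsIsometry π x y) := by
  induction y using UniformSpace.Completion.induction_on with
  | hp => exact isClosed_eq (by fun_prop) (by fun_prop)
  | ih a =>
    have h : (vectorFunctional π x).gnsStarAlgHom c a =
        (((vectorFunctional π x).leftMulMapPreGNS c a : (vectorFunctional π x).PreGNS) :
          (vectorFunctional π x).GNS) :=
      PositiveLinearMap.gnsNonUnitalStarAlgHom_apply_coe _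
    rw [h, gnsIsometry_coe, gnsIsometry_coe]
    simp

end VectorFunctional

/-! ### Extending representations to the enveloping von Neumann algebra -/

section Intertwiner

variable {A : Type u} {H : Type*} [CStarAlgebra A] [PartialOrder A] [StarOrderedRing A]
  [NormedAddCommGroup H] [InnerProductSpace ℂ H] [CompleteSpace H]

/-- The projection of the universal space onto the GNS space of a state. -/
def UniversalSpace.compCLM (f : State A) : UniversalSpace A →L[ℂ] f.1.GNS :=
  lp.evalCLM ℂ (fun f : State A => f.1.GNS) 2 f

open scoped Classical in
/-- The inclusion of the GNS space of a state into the universal space. -/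
def UniversalSpace.single (f : State A) : f.1.GNS →L[ℂ] UniversalSpace A :=
  lp.singleContinuousLinearMap ℂ (fun f : State A => f.1.GNS) 2 f

open scoped Classical in
theorem UniversalSpace.comp_single (f : State A) (x : f.1.GNS) :
    (UniversalSpace.single f x).comp f = x :=
  lp.single_apply_self (E := fun f : State A => f.1.GNS) 2 f x

theorem UniversalSpace.norm_comp_le (f : State A) (x : UniversalSpace A) :
    ‖x.comp f‖ ≤ ‖x‖ :=
  lp.norm_apply_le_norm (E := fun f : State A => f.1.GNS) two_ne_zero x f

open scoped Classical in
theorem UniversalSpace.norm_single (f : State A) (x : f.1.GNS) :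
    ‖UniversalSpace.single f x‖ = ‖x‖ :=
  lp.norm_single (E := fun f : State A => f.1.GNS) two_pos f x

/-- `V` intertwines the universal representation with `π`. -/
def Intertwines (π : A →⋆ₐ[ℂ] (H →L[ℂ] H)) (V : UniversalSpace A →L[ℂ] H) : Prop :=
  ∀ a ξ, V (universalRep A a ξ) = π a (V ξ)

/-- A unit vector gives a vector state, whose GNS space is a summand of the universal space.
Projecting to that summand and then mapping isometrically onto the cyclic subspace of `x`
intertwines; the class of `1` goes to `x`. -/
theorem exists_intertwines_of_norm_eq_one (π : A →⋆ₐ[ℂ] (H →L[ℂ] H)) (x : H) (hx : ‖x‖ = 1) :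
    ∃ V ξ, Intertwines π V ∧ V ξ = x ∧ ‖V‖ ≤ 1 ∧ ‖ξ‖ ≤ 1 := by
  let f : State A := ⟨vectorFunctional π x, by simp [vectorFunctional_apply, hx]⟩
  let ξ₀ : f.1.GNS := ((f.1.toPreGNS 1 : f.1.PreGNS) : f.1.GNS)
  have hξ₀ : gnsIsometry π x ξ₀ = x := by
    refine (gnsIsometry_coe π x _).trans ?_
    rw [PositiveLinearMap.ofPreGNS_toPreGNS, map_one]
    rfl
  refine ⟨(gnsIsometry π x).comp (UniversalSpace.compCLM f), UniversalSpace.single f ξ₀,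
    fun a ξ => ?_, ?_, ?_, ?_⟩
  · exact gnsIsometry_gnsStarAlgHom π x a (ξ.comp f)
  · change gnsIsometry π x ((UniversalSpace.single f ξ₀).comp f) = x
    rw [UniversalSpace.comp_single, hξ₀]
  · refine ContinuousLinearMap.opNorm_le_bound _ zero_le_one fun ξ => ?_
    change ‖gnsIsometry π x (ξ.comp f)‖ ≤ _
    rw [norm_gnsIsometry, one_mul]
    exact UniversalSpace.norm_comp_le f ξ
  · rw [UniversalSpace.norm_single, ← hx]
    conv_rhs => rw [← hξ₀]
    exact (norm_gnsIsometry π x ξ₀).ge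

theorem exists_intertwines (π : A →⋆ₐ[ℂ] (H →L[ℂ] H)) (x : H) :
    ∃ V ξ, Intertwines π V ∧ V ξ = x ∧ ‖V‖ ≤ 1 ∧ ‖ξ‖ ≤ ‖x‖ := by
  rcases eq_or_ne x 0 with rfl | hx
  · exact ⟨0, 0, fun _ _ => by simp, by simp, by simp, by simp⟩
  · have hx' : ‖((‖x‖ : ℂ)⁻¹) • x‖ = 1 := by
      rw [norm_smul, norm_inv, Complex.norm_real, norm_norm, inv_mul_cancel₀ (norm_ne_zero_iff.2 hx)]
    obtain ⟨V, ξ, hV, hξ, hV1, hξ1⟩ := exists_intertwines_of_norm_eq_one π _ hx'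
    refine ⟨V, (‖x‖ : ℂ) • ξ, hV, ?_, hV1, ?_⟩
    · rw [map_smul, hξ, smul_inv_smul₀]
      simpa using hx
    · rw [norm_smul, Complex.norm_real, norm_norm]
      exact mul_le_of_le_one_right (norm_nonneg _) hξ1

theorem Intertwines.adjoint_comp_commute {π : A →⋆ₐ[ℂ] (H →L[ℂ] H)}
    {V W : UniversalSpace A →L[ℂ] H} (hV : Intertwines π V) (hW : Intertwines π W) :
    W.adjoint.comp V ∈ StarSubalgebra.centralizer ℂ (Set.range (universalRep A)) := by
  have key : ∀ a, universalRep A a * W.adjoint.comp V = W.adjoint.comp V * universalRep A a := by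
    intro a
    ext1 ξ
    refine ext_inner_right ℂ fun η => ?_
    have h1 : inner ℂ (universalRep A a (W.adjoint (V ξ))) η
        = inner ℂ (W.adjoint (V ξ)) (universalRep A (star a) η) := by
      rw [map_star, ContinuousLinearMap.star_eq_adjoint, ContinuousLinearMap.adjoint_inner_right]
    have h2 : inner ℂ (V ξ) (π (star a) (W η)) = inner ℂ (π a (V ξ)) (W η) := by
      rw [map_star, ContinuousLinearMap.star_eq_adjoint, ContinuousLinearMap.adjoint_inner_right]
    change inner ℂ (universalRep A a (W.adjoint (V ξ))) η
      = inner ℂ (W.adjoint (V (universalRep A a ξ))) η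
    rw [h1, ContinuousLinearMap.adjoint_inner_left, ContinuousLinearMap.adjoint_inner_left, hW, h2,
      hV]
  rw [StarSubalgebra.mem_centralizer_iff]
  rintro _ ⟨a, rfl⟩
  exact ⟨key a, by rw [← map_star]; exact key (star a)⟩

/-- The operator `W⋆V` lies in the commutant of the universal representation, so `T` can be moved
past it. -/
theorem Intertwines.inner_apply_bicommutant {π : A →⋆ₐ[ℂ] (H →L[ℂ] H)}
    {V W : UniversalSpace A →L[ℂ] H} (hV : Intertwines π V) (hW : Intertwines π W)
    (T : Bidual A) (ξ η : UniversalSpace A) :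
    inner ℂ (V (T.1 ξ)) (W η) = inner ℂ (V ξ) (W ((star T).1 η)) := by
  have h := ((StarSubalgebra.mem_centralizer_iff ℂ).mp T.2 _ (hV.adjoint_comp_commute hW)).1
  have h' := congrArg (fun S : UniversalSpace A →L[ℂ] UniversalSpace A => inner ℂ (S ξ) η) h
  change inner ℂ (W.adjoint (V (T.1 ξ))) η = inner ℂ (T.1 (W.adjoint (V ξ))) η at h'
  have hs : (star T).1 = T.1.adjoint := rfl
  rw [hs, ← ContinuousLinearMap.adjoint_inner_left W, h', ← ContinuousLinearMap.adjoint_inner_left W,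
    ContinuousLinearMap.adjoint_inner_right]

variable (π : A →⋆ₐ[ℂ] (H →L[ℂ] H))

/-- The value at `x` of the normal extension of `π`. -/
def normalExtensionFun (T : Bidual A) (x : H) : H :=
  (exists_intertwines π x).choose (T.1 (exists_intertwines π x).choose_spec.choose)

/-- The left side does not involve the choices made for `y`, nor the right side those made for `x`.
This yields independence of choices, linearity in `x` and compatibility with the adjoint. -/
theorem inner_normalExtensionFun (T : Bidual A) (x y : H) :
    inner ℂ (normalExtensionFun π T x) y = inner ℂ x (normalExtensionFun π (star T) y) := by
  obtain ⟨hV, hVx, -⟩ := (exists_intertwines π x).choose_spec.choose_spec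
  obtain ⟨hW, hWy, -⟩ := (exists_intertwines π y).choose_spec.choose_spec
  have := hV.inner_apply_bicommutant hW T (exists_intertwines π x).choose_spec.choose
    (exists_intertwines π y).choose_spec.choose
  rwa [hVx, hWy] at this

theorem norm_normalExtensionFun_le (T : Bidual A) (x : H) :
    ‖normalExtensionFun π T x‖ ≤ ‖T.1‖ * ‖x‖ := by
  obtain ⟨-, -, hV, hξ⟩ := (exists_intertwines π x).choose_spec.choose_spec
  refine (ContinuousLinearMap.le_of_opNorm_le _ hV _).trans ?_
  rw [one_mul]
  exact (ContinuousLinearMap.le_opNorm _ _).trans (by gcongr)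

theorem normalExtensionFun_intertwiner {V : UniversalSpace A →L[ℂ] H} (hV : Intertwines π V)
    (T : Bidual A) (ξ : UniversalSpace A) : normalExtensionFun π T (V ξ) = V (T.1 ξ) := by
  refine ext_inner_right ℂ fun y => ?_
  obtain ⟨hW, hWy, -⟩ := (exists_intertwines π y).choose_spec.choose_spec
  have := hV.inner_apply_bicommutant hW T ξ (exists_intertwines π y).choose_spec.choose
  rw [hWy] at this
  rw [this, inner_normalExtensionFun]
  rfl

/-- The operator on `H` that the normal extension of `π` assigns to `T`. -/
def normalExtensionCLM (T : Bidual A) : H →L[ℂ] H :=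
  LinearMap.mkContinuous
    { toFun := normalExtensionFun π T
      map_add' := fun x y => ext_inner_right ℂ fun z => by
        simp only [inner_add_left, inner_normalExtensionFun]
      map_smul' := fun c x => ext_inner_right ℂ fun z => by
        simp only [inner_smul_left, inner_normalExtensionFun, RingHom.id_apply] }
    ‖T.1‖ (norm_normalExtensionFun_le π T)

theorem normalExtensionCLM_intertwiner {V : UniversalSpace A →L[ℂ] H} (hV : Intertwines π V)
    (T : Bidual A) (ξ : UniversalSpace A) : normalExtensionCLM π T (V ξ) = V (T.1 ξ) :=
  normalExtensionFun_intertwiner π hV T ξ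

variable {π} in
theorem ext_intertwiner {S T : H →L[ℂ] H}
    (h : ∀ V ξ, Intertwines π V → S (V ξ) = T (V ξ)) : S = T := by
  ext x
  obtain ⟨V, ξ, hV, rfl, -⟩ := exists_intertwines π x
  exact h V ξ hV

theorem normalExtensionCLM_toBidual (a : A) : normalExtensionCLM π (toBidual A a) = π a :=
  ext_intertwiner (π := π) fun V ξ hV => by
    rw [normalExtensionCLM_intertwiner π hV]
    exact hV a ξ

/-- The extension of a representation `π` of `A` to a representation of the enveloping
von Neumann algebra. -/
def normalExtension : Bidual A →⋆ₐ[ℂ] (H →L[ℂ] H) where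
  toFun := normalExtensionCLM π
  map_one' := ext_intertwiner (π := π) fun V ξ hV => by
    rw [normalExtensionCLM_intertwiner π hV]; rfl
  map_mul' S T := ext_intertwiner (π := π) fun V ξ hV => by
    change _ = normalExtensionCLM π S (normalExtensionCLM π T (V ξ))
    rw [normalExtensionCLM_intertwiner π hV, normalExtensionCLM_intertwiner π hV,
      normalExtensionCLM_intertwiner π hV]
    rfl
  map_zero' := ext_intertwiner (π := π) fun V ξ hV => by
    rw [normalExtensionCLM_intertwiner π hV]; exact map_zero V
  map_add' S T := ext_intertwiner (π := π) fun V ξ hV => by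
    rw [normalExtensionCLM_intertwiner π hV, add_apply,
      normalExtensionCLM_intertwiner π hV, normalExtensionCLM_intertwiner π hV]
    exact map_add V _ _
  commutes' r := ext_intertwiner (π := π) fun V ξ hV => by
    rw [normalExtensionCLM_intertwiner π hV]
    exact map_smul V r ξ
  map_star' T := by
    rw [ContinuousLinearMap.star_eq_adjoint, ContinuousLinearMap.eq_adjoint_iff]
    intro x y
    have := inner_normalExtensionFun π (star T) x y
    rwa [star_star] at this

theorem normalExtension_toBidual (a : A) : normalExtension π (toBidual A a) = π a :=
  normalExtensionCLM_toBidual π a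

theorem normalExtension_intertwiner {V : UniversalSpace A →L[ℂ] H} (hV : Intertwines π V)
    (T : Bidual A) (ξ : UniversalSpace A) : normalExtension π T (V ξ) = V (T.1 ξ) :=
  normalExtensionCLM_intertwiner π hV T ξ

/-- If `S` commutes with `π(A)` and `V` is an intertwiner, then so is `S ∘ V`; hence both orders of
composition send `V ξ` to `S V T ξ`. -/
theorem normalExtension_mem_bicommutant (T : Bidual A) :
    normalExtension π T ∈ bicommutant π := by
  have key : ∀ S ∈ StarSubalgebra.centralizer ℂ (Set.range π),
      S * normalExtension π T = normalExtension π T * S := by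
    intro S hS
    refine ext_intertwiner (π := π) fun V ξ hV => ?_
    have hSV : Intertwines π (S.comp V) := fun a η => by
      have h := ((StarSubalgebra.mem_centralizer_iff ℂ).mp hS (π a) ⟨a, rfl⟩).1
      have h' := congrArg (fun R : H →L[ℂ] H => R (V η)) h
      change S (V (universalRep A a η)) = _
      rw [hV]
      exact h'.symm
    change S (normalExtension π T (V ξ)) = normalExtension π T (S.comp V ξ)
    rw [normalExtension_intertwiner π hV, normalExtension_intertwiner π hSV]
    rfl
  rw [bicommutant, StarSubalgebra.mem_centralizer_iff]
  exact fun S hS => ⟨key S hS, key _ (star_mem hS)⟩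

end Intertwiner

/-! ### Functoriality of the double dual -/

section BidualMap

variable {C : Type u} {A : Type v} [CStarAlgebra C] [CStarAlgebra A]

theorem bicommutant_comp_le {H : Type*} [NormedAddCommGroup H] [InnerProductSpace ℂ H]
    [CompleteSpace H] (π : A →⋆ₐ[ℂ] (H →L[ℂ] H)) (j : C →⋆ₐ[ℂ] A) :
    bicommutant (π.comp j) ≤ bicommutant π := by
  refine StarSubalgebra.centralizer_le _ _ _ (StarSubalgebra.centralizer_le _ _ _ ?_)
  rintro _ ⟨c, rfl⟩
  exact ⟨j c, rfl⟩

variable [PartialOrder C] [StarOrderedRing C] [PartialOrder A] [StarOrderedRing A]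

/-- The ⋆-homomorphism `C⋆⋆ → A⋆⋆` extending a ⋆-homomorphism `C → A`. -/
def bidualMap (j : C →⋆ₐ[ℂ] A) : Bidual C →⋆ₐ[ℂ] Bidual A :=
  (normalExtension ((universalRep A).comp j)).codRestrict (bicommutant (universalRep A)) fun T =>
    bicommutant_comp_le _ j (normalExtension_mem_bicommutant _ T)

theorem bidualMap_toBidual (j : C →⋆ₐ[ℂ] A) (c : C) :
    bidualMap j (toBidual C c) = toBidual A (j c) :=
  Subtype.ext (normalExtension_toBidual ((universalRep A).comp j) c)

end BidualMap

/-! ### Positivity of operator matrices through quadratic forms -/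

section MatrixPositivity

variable {D : Type*} [CStarAlgebra D]
variable {H : Type*} [NormedAddCommGroup H] [InnerProductSpace ℂ H] [CompleteSpace H]
variable {n : Type*} [Fintype n]

/-- An injective ⋆-homomorphism preserves spectra of self-adjoint elements, so it reflects
positivity. -/
theorem nonneg_of_map_nonneg [PartialOrder D] [StarOrderedRing D] {E : Type*} [CStarAlgebra E] [PartialOrder E] [StarOrderedRing E]
    (φ : D →⋆ₐ[ℂ] E) (hφ : Function.Injective φ) {a : D} (ha : 0 ≤ φ a) : 0 ≤ a := by
  have hsa : IsSelfAdjoint a := hφ (by rw [map_star]; exact (IsSelfAdjoint.of_nonneg ha).star_eq)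
  rw [StarOrderedRing.nonneg_iff_spectrum_nonneg (R := ℝ) a hsa]
  rw [StarOrderedRing.nonneg_iff_spectrum_nonneg (R := ℝ) (φ a) (hsa.map φ),
    hsa.map_spectrum_real φ hφ] at ha
  exact ha

/-- The operator on `Hⁿ` given by a matrix of operators on `H`. -/
def matrixOp (ρ : D →⋆ₐ[ℂ] (H →L[ℂ] H)) (M : CStarMatrix n n D) :
    PiLp 2 (fun _ : n => H) →L[ℂ] PiLp 2 (fun _ : n => H) :=
  (PiLp.continuousLinearEquiv 2 ℂ (fun _ : n => H)).symm.toContinuousLinearMap.comp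
    (ContinuousLinearMap.pi fun i => ∑ j, (ρ (M i j)).comp (PiLp.proj 2 (fun _ : n => H) j))

theorem matrixOp_apply (ρ : D →⋆ₐ[ℂ] (H →L[ℂ] H)) (M : CStarMatrix n n D)
    (x : PiLp 2 (fun _ : n => H)) (i : n) : matrixOp ρ M x i = ∑ j, ρ (M i j) (x j) := by
  simp [matrixOp]

variable [DecidableEq n] [PartialOrder D] [StarOrderedRing D]

/-- The amplification of a representation of `D` on `H` to a representation of the matrix algebra
on `Hⁿ`. -/
def matrixRep (ρ : D →⋆ₐ[ℂ] (H →L[ℂ] H)) :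
    CStarMatrix n n D →⋆ₐ[ℂ] (PiLp 2 (fun _ : n => H) →L[ℂ] PiLp 2 (fun _ : n => H)) where
  toFun := matrixOp ρ
  map_one' := by
    ext x i
    rw [matrixOp_apply, Finset.sum_eq_single i]
    · simp
    · intro j _ hj
      simp [CStarMatrix.one_apply_ne hj.symm]
    · simp
  map_mul' M N := by
    ext x i
    change _ = matrixOp ρ M (matrixOp ρ N x) i
    rw [matrixOp_apply, matrixOp_apply]
    simp only [matrixOp_apply, map_sum, CStarMatrix.mul_apply, map_mul,
      sum_apply]
    exact Finset.sum_comm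
  map_zero' := by
    ext x i
    rw [matrixOp_apply]
    simp
  map_add' M N := by
    ext x i
    rw [add_apply, PiLp.add_apply]
    simp only [matrixOp_apply, CStarMatrix.add_apply, map_add, add_apply,
      Finset.sum_add_distrib]
  commutes' r := by
    ext x i
    rw [matrixOp_apply, Finset.sum_eq_single i]
    · simp [CStarMatrix.algebraMap_apply, Algebra.algebraMap_eq_smul_one]
    · intro j _ hj
      simp [CStarMatrix.algebraMap_apply, hj.symm]
    · simp
  map_star' M := by
    rw [ContinuousLinearMap.star_eq_adjoint, ContinuousLinearMap.eq_adjoint_iff]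
    intro x y
    simp only [PiLp.inner_apply, matrixOp_apply, sum_inner, inner_sum, CStarMatrix.star_apply,
      map_star, ContinuousLinearMap.star_eq_adjoint, ContinuousLinearMap.adjoint_inner_left]
    exact Finset.sum_comm

theorem matrixRep_apply (ρ : D →⋆ₐ[ℂ] (H →L[ℂ] H)) (M : CStarMatrix n n D)
    (x : PiLp 2 (fun _ : n => H)) (i : n) : matrixRep ρ M x i = ∑ j, ρ (M i j) (x j) :=
  matrixOp_apply ρ M x i

theorem matrixRep_injective (ρ : D →⋆ₐ[ℂ] (H →L[ℂ] H)) (hρ : Function.Injective ρ) :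
    Function.Injective (matrixRep (n := n) ρ) := by
  rw [injective_iff_map_eq_zero]
  intro M hM
  ext i j
  refine (map_eq_zero_iff ρ hρ).mp ?_
  ext x
  have h := congrArg (fun T : PiLp 2 (fun _ : n => H) →L[ℂ] PiLp 2 (fun _ : n => H) =>
    T (WithLp.toLp 2 (Pi.single j x)) i) hM
  simp only [matrixRep_apply] at h
  rw [Finset.sum_eq_single j] at h
  · simpa using h
  · intro k _ hk
    simp [Pi.single_eq_of_ne hk]
  · simp

/-- A matrix over `D` is positive iff its quadratic form in a faithful representation of `D` is. -/
theorem cstarMatrix_nonneg_iff (ρ : D →⋆ₐ[ℂ] (H →L[ℂ] H)) (hρ : Function.Injective ρ)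
    (M : CStarMatrix n n D) :
    0 ≤ M ↔ ∀ x : n → H, 0 ≤ ∑ i, ∑ j, inner ℂ (ρ (M i j) (x j)) (x i) := by
  have hq : ∀ x : PiLp 2 (fun _ : n => H), inner ℂ (matrixRep ρ M x) x
      = ∑ i, ∑ j, inner ℂ (ρ (M i j) (x j)) (x i) := fun x => by
    simp only [PiLp.inner_apply, matrixRep_apply, sum_inner]
  have h1 : 0 ≤ M ↔ 0 ≤ matrixRep ρ M :=
    ⟨fun h => map_nonneg (matrixRep ρ) h, nonneg_of_map_nonneg _ (matrixRep_injective ρ hρ)⟩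
  rw [h1, ContinuousLinearMap.nonneg_iff_isPositive, ContinuousLinearMap.isPositive_iff_complex]
  simp only [hq]
  constructor
  · intro h x
    obtain ⟨h2, h3⟩ := h (WithLp.toLp 2 x)
    rw [← h2]
    exact_mod_cast h3
  · intro h x
    have := h x
    rw [Complex.le_def] at this
    refine ⟨Complex.ext rfl ?_, this.1⟩
    exact this.2

end MatrixPositivity

/-! ### Weak operator limits along ultrafilters -/

section WeakLimit

variable {H : Type*} [NormedAddCommGroup H] [InnerProductSpace ℂ H] [CompleteSpace H]

/-- A bounded family of operators converges in the weak operator topology along an ultrafilter. -/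
theorem exists_tendsto_inner_of_bounded {I : Type*} (l : Ultrafilter I) (T : I → H →L[ℂ] H) (K : ℝ)
    (hT : ∀ i, ‖T i‖ ≤ K) :
    ∃ S : H →L[ℂ] H, ∀ x y,
      Filter.Tendsto (fun i => inner ℂ (T i x) y) l (nhds (inner ℂ (S x) y)) := by
  have hb : ∀ x y i, ‖inner ℂ (T i x) y‖ ≤ K * ‖x‖ * ‖y‖ := fun x y i =>
    (norm_inner_le_norm _ _).trans
      (by gcongr; exact ContinuousLinearMap.le_of_opNorm_le _ (hT i) x)
  have hlim : ∀ x y, ∃ c : ℂ, ‖c‖ ≤ K * ‖x‖ * ‖y‖ ∧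
      Filter.Tendsto (fun i => inner ℂ (T i x) y) l (nhds c) := by
    intro x y
    -- Each matrix coefficient stays in a compact disc, so it converges along the ultrafilter.
    obtain ⟨c, hc, hlc⟩ := (isCompact_closedBall (0 : ℂ) (K * ‖x‖ * ‖y‖)).ultrafilter_le_nhds
      (l.map fun i => inner ℂ (T i x) y)
      (by
        rw [Ultrafilter.coe_map, Filter.le_principal_iff]
        exact Filter.mem_map.mpr (Filter.univ_mem' fun i => by simpa using hb x y i))
    exact ⟨c, by simpa using hc, hlc⟩
  choose b hbK hbl using hlim
  -- Uniqueness of limits makes the limiting coefficients a bounded sesquilinear form, which an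
  -- operator represents.
  let B : H →L⋆[ℂ] H →L[ℂ] ℂ := LinearMap.mkContinuous₂
    (LinearMap.mk₂'ₛₗ (starRingEnd ℂ) (RingHom.id ℂ) b
      (fun x x' y => tendsto_nhds_unique (hbl (x + x') y)
        (by simpa only [map_add, inner_add_left] using (hbl x y).add (hbl x' y)))
      (fun c x y => tendsto_nhds_unique (hbl (c • x) y)
        (by simpa only [map_smul, inner_smul_left, smul_eq_mul] using (hbl x y).const_mul _))
      (fun x y y' => tendsto_nhds_unique (hbl x (y + y'))
        (by simpa only [inner_add_right] using (hbl x y).add (hbl x y')))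
      (fun c x y => tendsto_nhds_unique (hbl x (c • y))
        (by simpa only [inner_smul_right, smul_eq_mul, RingHom.id_apply] using (hbl x y).const_mul _))) K hbK
  refine ⟨InnerProductSpace.continuousLinearMapOfBilin B, fun x y => ?_⟩
  rw [InnerProductSpace.continuousLinearMapOfBilin_apply]
  exact hbl x y

end WeakLimit

/-! ### Composition and norm bounds for completely positive maps -/

section CompletelyPositive

variable {B C D : Type*} [CStarAlgebra B] [PartialOrder B] [StarOrderedRing B]
  [CStarAlgebra C] [PartialOrder C] [StarOrderedRing C]
  [CStarAlgebra D] [PartialOrder D] [StarOrderedRing D]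

/-- A completely positive map followed by a ⋆-homomorphism is completely positive. -/
def starAlgHomCompCP (ρ : C →⋆ₐ[ℂ] D) (φ : CompletelyPositiveMap B C) :
    CompletelyPositiveMap B D where
  toLinearMap := ρ.toAlgHom.toLinearMap.comp φ.toLinearMap
  map_cstarMatrix_nonneg' k M hM :=
    CompletelyPositiveMapClass.map_cstarMatrix_nonneg' ρ k _ (φ.map_cstarMatrix_nonneg' k M hM)

theorem starAlgHomCompCP_apply (ρ : C →⋆ₐ[ℂ] D) (φ : CompletelyPositiveMap B C) (b : B) :
    starAlgHomCompCP ρ φ b = ρ (φ b) := rfl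

/-- The factor `4` counts the positive parts in `b = ∑ iᵏ yₖ`, each of norm at most `‖b‖`. It is not
sharp; only a bound uniform over unital maps is needed. -/
theorem norm_completelyPositiveMap_le (φ : CompletelyPositiveMap B C) (b : B) :
    ‖φ b‖ ≤ 4 * (‖φ 1‖ * ‖b‖) := by
  obtain ⟨y, hy0, hyn, hy⟩ := CStarAlgebra.exists_sum_four_nonneg b
  conv_lhs => rw [hy]
  rw [map_sum]
  refine (norm_sum_le_of_le _ (fun i _ => ?_ : ∀ i ∈ Finset.univ, _ ≤ ‖φ 1‖ * ‖b‖)).trans_eq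
    (by simp)
  rw [map_smul, norm_smul, norm_pow, Complex.norm_I, one_pow, one_mul]
  exact (PositiveLinearMap.norm_apply_le_of_nonneg (PositiveLinearMap.ofClass φ) (y i)
    (hy0 i)).trans (mul_le_mul_of_nonneg_left (hyn i) (norm_nonneg _))

end CompletelyPositive

/-! ### Limits of completely positive maps into a von Neumann algebra -/

section Limit

variable {A H : Type*} [CStarAlgebra A] [NormedAddCommGroup H] [InnerProductSpace ℂ H]
  [CompleteSpace H]

/-- The double commutant is closed under limits in the weak operator topology. -/
theorem mem_bicommutant_of_tendsto (π : A →⋆ₐ[ℂ] (H →L[ℂ] H)) {I : Type*} {l : Filter I} [l.NeBot]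
    {T : I → H →L[ℂ] H} (hT : ∀ i, T i ∈ bicommutant π) {S : H →L[ℂ] H}
    (hS : ∀ x y, Filter.Tendsto (fun i => inner ℂ (T i x) y) l (nhds (inner ℂ (S x) y))) :
    S ∈ bicommutant π := by
  have key : ∀ R ∈ StarSubalgebra.centralizer ℂ (Set.range π), R * S = S * R := by
    intro R hR
    ext1 x
    refine ext_inner_right ℂ fun y => ?_
    refine tendsto_nhds_unique ?_ (hS (R x) y)
    change Filter.Tendsto _ l (nhds (inner ℂ (R (S x)) y))
    rw [← ContinuousLinearMap.adjoint_inner_right]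
    refine (hS x (R.adjoint y)).congr fun i => ?_
    have h := ((StarSubalgebra.mem_centralizer_iff ℂ).mp (hT i) R hR).1
    rw [ContinuousLinearMap.adjoint_inner_right]
    exact congrArg (fun Q : H →L[ℂ] H => inner ℂ (Q x) y) h
  rw [bicommutant, StarSubalgebra.mem_centralizer_iff]
  exact fun R hR => ⟨key R hR, key _ (star_mem hR)⟩

variable {B : Type*} [CStarAlgebra B] [PartialOrder B] [StarOrderedRing B]

/-- Unital completely positive maps into a von Neumann algebra have a limit along an ultrafilter,
pointwise in the weak operator topology. -/
theorem exists_completelyPositiveMap_tendsto (π : A →⋆ₐ[ℂ] (H →L[ℂ] H))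
    [PartialOrder (bicommutant π)] [StarOrderedRing (bicommutant π)]
    {I : Type*} (l : Ultrafilter I) (φ : I → CompletelyPositiveMap B (bicommutant π))
    (hφ : ∀ i, φ i 1 = 1) :
    ∃ ψ : CompletelyPositiveMap B (bicommutant π), ∀ b x y,
      Filter.Tendsto (fun i => inner ℂ ((φ i b).1 x) y) l (nhds (inner ℂ ((ψ b).1 x) y)) := by
  have hbound : ∀ i b, ‖(φ i b).1‖ ≤ 4 * ‖b‖ := by
    intro i b
    refine (norm_completelyPositiveMap_le (φ i) b).trans ?_
    -- Only an inequality, since `H` may be zero.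
    have h1 : ‖φ i 1‖ ≤ 1 := by
      rw [hφ]
      exact ContinuousLinearMap.norm_id_le
    nlinarith [norm_nonneg b]
  choose S hS using fun b => exists_tendsto_inner_of_bounded l (fun i => (φ i b).1) (4 * ‖b‖)
    (fun i => hbound i b)
  have hmem : ∀ b, S b ∈ bicommutant π := fun b =>
    mem_bicommutant_of_tendsto π (fun i => (φ i b).2) (hS b)
  let ψ : B →ₗ[ℂ] bicommutant π :=
    { toFun b := ⟨S b, hmem b⟩
      map_add' b c := Subtype.ext <| by
        ext1 x
        refine ext_inner_right ℂ fun y => tendsto_nhds_unique (hS (b + c) x y) ?_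
        change Filter.Tendsto _ _ (nhds (inner ℂ (S b x + S c x) y))
        rw [inner_add_left]
        refine ((hS b x y).add (hS c x y)).congr fun i => ?_
        rw [map_add, ← inner_add_left]
        rfl
      map_smul' r b := Subtype.ext <| by
        ext1 x
        refine ext_inner_right ℂ fun y => tendsto_nhds_unique (hS (r • b) x y) ?_
        change Filter.Tendsto _ _ (nhds (inner ℂ (r • S b x) y))
        rw [inner_smul_left]
        refine ((hS b x y).const_mul _).congr fun i => ?_
        rw [map_smul, ← inner_smul_left]
        rfl }
  refine ⟨⟨ψ, fun k M hM => ?_⟩, hS⟩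
  -- The quadratic form is a finite sum of convergent coefficients, so its nonnegativity passes to
  -- the limit.
  rw [cstarMatrix_nonneg_iff (bicommutant π).subtype Subtype.val_injective]
  intro x
  refine ge_of_tendsto' (tendsto_finsetSum
    (f := fun a i => ∑ j, inner ℂ ((φ i (M a j)).1 (x j)) (x a)) _ fun a _ =>
      tendsto_finsetSum _ fun j _ => hS (M a j) (x j) (x a)) fun i => ?_
  exact (cstarMatrix_nonneg_iff (bicommutant π).subtype Subtype.val_injective _).mp
    ((φ i).map_cstarMatrix_nonneg' k M hM) x

end Limit

/-! ### Separable subalgebras generated by separable sets -/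

section Separable

variable {A : Type*} [CStarAlgebra A]

theorem countable_submonoidClosure {M : Type*} [Monoid M] {s : Set M} (hs : s.Countable) :
    (Submonoid.closure s : Set M).Countable := by
  have : Countable s := hs
  have : Countable (FreeMonoid s) := inferInstanceAs (Countable (List s))
  rw [Submonoid.closure_eq_mrange]
  exact Set.countable_range _

/-- For `c` countable with `s` in its closure, the ⋆-algebra generated by `c` is the span of the
countable monoid generated by `c ∪ star c`, so its closure is separable. -/
theorem exists_separable_starSubalgebra {s : Set A} (hs : TopologicalSpace.IsSeparable s) :
    ∃ S : StarSubalgebra ℂ A, IsClosed (S : Set A) ∧ TopologicalSpace.SeparableSpace S ∧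
      s ⊆ S := by
  obtain ⟨c, hc, hsc⟩ := hs
  refine ⟨(StarAlgebra.adjoin ℂ c).topologicalClosure,
    StarSubalgebra.isClosed_topologicalClosure _, ?_, ?_⟩
  · have h : TopologicalSpace.IsSeparable
        (Submodule.span ℂ (Submonoid.closure (c ∪ star c) : Set A) : Set A) :=
      (countable_submonoidClosure (hc.union
        (by rw [← Set.image_star]; exact hc.image _))).isSeparable.span
    rw [← StarAlgebra.adjoin_eq_span] at h
    exact h.closure.separableSpace
  · rw [StarSubalgebra.topologicalClosure_coe]
    exact hsc.trans (closure_mono (StarAlgebra.subset_adjoin ℂ c))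

end Separable

/-! ### Weak expectations from subalgebras and from limits -/

section WEP

/-- If a net of unital completely positive maps `B → A⋆⋆` eventually fixes each element of `A`, then
there is a weak expectation `B → A⋆⋆`. -/
theorem exists_weakExpectation_of_eventually {A : Type u} {B : Type v}
    [CStarAlgebra A] [PartialOrder A] [StarOrderedRing A]
    [CStarAlgebra B] [PartialOrder B] [StarOrderedRing B]
    [PartialOrder (Bidual A)] [StarOrderedRing (Bidual A)]
    (ι : A →⋆ₐ[ℂ] B) {I : Type*} (l : Ultrafilter I)
    (φ : I → CompletelyPositiveMap B (Bidual A)) (hφ : ∀ i, φ i 1 = 1)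
    (h : ∀ a, ∀ᶠ i in l, φ i (ι a) = toBidual A a) :
    ∃ ψ : CompletelyPositiveMap B (Bidual A), ψ 1 = 1 ∧ ∀ a, ψ (ι a) = toBidual A a := by
  obtain ⟨ψ, hψ⟩ := exists_completelyPositiveMap_tendsto (universalRep A) l φ hφ
  have key : ∀ a, ψ (ι a) = toBidual A a := fun a => Subtype.ext <| by
    ext1 x
    refine ext_inner_right ℂ fun y => tendsto_nhds_unique (hψ (ι a) x y) ?_
    exact tendsto_const_nhds.congr' ((h a).mono fun i hi => by simp only [hi])
  refine ⟨ψ, ?_, key⟩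
  rw [← map_one ι, key, map_one]

theorem exists_weakExpectation_bidual {C A : Type u} {B : Type v} [CStarAlgebra C]
    [PartialOrder C] [StarOrderedRing C] [CStarAlgebra A] [PartialOrder A] [StarOrderedRing A]
    [CStarAlgebra B] [PartialOrder B] [StarOrderedRing B]
    [PartialOrder (Bidual C)] [StarOrderedRing (Bidual C)]
    [PartialOrder (Bidual A)] [StarOrderedRing (Bidual A)] (j : C →⋆ₐ[ℂ] A) (ι : A →⋆ₐ[ℂ] B)
    (h : ∃ φ : CompletelyPositiveMap B (Bidual C), φ 1 = 1 ∧
      ∀ c, φ (ι.comp j c) = toBidual C c) :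
    ∃ φ : CompletelyPositiveMap B (Bidual A), φ 1 = 1 ∧ ∀ c, φ (ι (j c)) = toBidual A (j c) := by
  obtain ⟨φ, hφ1, hφ⟩ := h
  refine ⟨starAlgHomCompCP (bidualMap j) φ, ?_, fun c => ?_⟩
  · rw [starAlgHomCompCP_apply, hφ1, map_one]
  · rw [starAlgHomCompCP_apply, ← bidualMap_toBidual, ← hφ]
    rfl

end WEP

end CStarWEP

end

theorem mainTheorem7 {A : Type u} [CStarAlgebra A]
    (hA : ¬ TopologicalSpace.SeparableSpace A)
    (𝒞 : Set (StarSubalgebra ℂ A))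
    (hclosed : ∀ C ∈ 𝒞, IsClosed (C : Set A))
    (hsep : ∀ C ∈ 𝒞, TopologicalSpace.SeparableSpace C)
    (hcofinal : ∀ S : StarSubalgebra ℂ A, IsClosed (S : Set A) →
      TopologicalSpace.SeparableSpace S → ∃ C ∈ 𝒞, S ≤ C)
    (hWEP : ∀ (C : StarSubalgebra ℂ A) (hC : C ∈ 𝒞),
      haveI : IsClosed (C : Set A) := hclosed C hC
      CStarWEP.HasWEP.{u, v} C) :
    CStarWEP.HasWEP.{u, v} A := by
  have hsub : ∀ s : Set A, TopologicalSpace.IsSeparable s → ∃ C ∈ 𝒞, s ⊆ C := by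
    intro s hs
    obtain ⟨S, hS, hSsep, hsS⟩ := CStarWEP.exists_separable_starSubalgebra hs
    obtain ⟨C, hC, hSC⟩ := hcofinal S hS hSsep
    exact ⟨C, hC, hsS.trans hSC⟩
  have hsep' : ∀ C : 𝒞, TopologicalSpace.IsSeparable (C.1 : Set A) := fun C =>
    have := hsep C.1 C.2
    TopologicalSpace.IsSeparable.of_subtype (C.1 : Set A)
  have : Nonempty 𝒞 := by
    obtain ⟨C, hC, -⟩ := hsub ∅ Set.countable_empty.isSeparable
    exact ⟨⟨C, hC⟩⟩
  -- The union of two members is separable, hence lies in a third by cofinality.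
  have : IsDirectedOrder 𝒞 := ⟨fun C D => by
    obtain ⟨E, hE, hCDE⟩ := hsub _ ((hsep' C).union (hsep' D))
    exact ⟨⟨E, hE⟩, Set.subset_union_left.trans hCDE, Set.subset_union_right.trans hCDE⟩⟩
  intro B _ ι hι
  let := CStarAlgebra.spectralOrder A
  let := CStarAlgebra.spectralOrderedRing A
  let := CStarAlgebra.spectralOrder B
  let := CStarAlgebra.spectralOrderedRing B
  let := CStarAlgebra.spectralOrder (CStarWEP.Bidual A)
  let := CStarAlgebra.spectralOrderedRing (CStarWEP.Bidual A)
  have hexp : ∀ C : 𝒞, ∃ φ : CompletelyPositiveMap B (CStarWEP.Bidual A), φ 1 = 1 ∧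
      ∀ a ∈ C.1, φ (ι a) = CStarWEP.toBidual A a := by
    intro C
    have : IsClosed (C.1 : Set A) := hclosed C.1 C.2
    let := CStarAlgebra.spectralOrder C.1
    let := CStarAlgebra.spectralOrderedRing C.1
    let := CStarAlgebra.spectralOrder (CStarWEP.Bidual C.1)
    let := CStarAlgebra.spectralOrderedRing (CStarWEP.Bidual C.1)
    obtain ⟨φ, hφ1, hφ⟩ := CStarWEP.exists_weakExpectation_bidual C.1.subtype ι
      (hWEP C.1 C.2 B (ι.comp C.1.subtype) (hι.comp Subtype.val_injective))
    exact ⟨φ, hφ1, fun a ha => hφ ⟨a, ha⟩⟩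
  choose φ hφ1 hφ using hexp
  -- The ultrafilter refines `atTop` on `𝒞`; some `C` contains `a`, and every `φ D` with `C ≤ D`
  -- then fixes `a`.
  refine CStarWEP.exists_weakExpectation_of_eventually ι (Ultrafilter.of (Filter.atTop : Filter 𝒞))
    φ hφ1 fun a => Ultrafilter.of_le _ ?_
  obtain ⟨C, hC, haC⟩ := hsub {a} (Set.countable_singleton a).isSeparable
  filter_upwards [Filter.eventually_ge_atTop (⟨C, hC⟩ : 𝒞)] with D hD
  exact hφ D a (hD (haC rfl))
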